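/- Let $H$ be a finite-dimensional complex Hilbert space and let $\mathcal{L}$ and $\mathcal{D}$ be arbitrary GKLS generators on the space $B(H)$ of operators on $H$, i.e. linear maps $B(H)\to B(H)$ of the form $$\rho\mapsto -\mathrm{i}[K,\rho]-\tfrac12\sum_{i=1}^m\left(V_i^\dagger V_i\rho+\rho V_i^\dagger V_i-2V_i\rho V_i^\dagger\right)$$ with a Hermitian operator $K$ on $H$ and finitely many operators $V_1,\dots,V_m$ on $H$. Let $\{\alpha_k\}$ be the set of distinct eigenvalues of $\mathcal{D}$ and $\{\mathcal{P}_k\}$ its spectral projections, i.e. $\mathcal{P}_k$ is the projection onto the generalized eigenspace of $\mathcal{D}$ at $\alpha_k$ along the sum of its other generalized eigenspaces. Put $$\mathcal{L}_Z=\sum_{\alpha_k\in\mathrm{i}\mathbb{R}}\mathcal{P}_k\mathcal{L}\mathcal{P}_k,\qquad \mathcal{P}_\varphi=\sum_{\alpha_k\in\mathrm{i}\mathbb{R}}\mathcal{P}_k .$$ Then $$\mathrm{e}^{t(\gamma\mathcal{D}+\mathcal{L})}=\mathrm{e}^{t\gamma\mathcal{D}}\,\mathrm{e}^{t\mathcal{L}_Z}+\mathcal{O}(1/\gamma)\quad\text{as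 }\gamma\to+\infty,$$ uniformly in $t$ on compact subsets of $[0,+\infty)$, and $$\mathrm{e}^{t(\gamma\mathcal{D}+\mathcal{L})}=\mathrm{e}^{t\gamma\mathcal{D}}\,\mathrm{e}^{t\mathcal{L}_Z}\,\mathcal{P}_\varphi+\mathcal{O}(1/\gamma)\quad\text{as }\gamma\to+\infty,$$ uniformly in $t$ on compact subsets of $(0,+\infty)$. Here $\mathcal{O}(1/\gamma)$, uniformly in $t\in S$, means that there are constants $c$ and $\gamma_0>0$ such that the norm of the remainder is at most $c/\gamma$ for all $\gamma\ge\gamma_0$ and all $t\in S$. -/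

import Mathlib

open scoped InnerProduct

noncomputable section

/-- Generators in Gorini-Kossakowski-Lindblad-Sudarshan form on the operators of a complex Hilbert
space `H`: `ρ ↦ -i[K, ρ] - 1/2 ∑ᵢ (Vᵢ† Vᵢ ρ + ρ Vᵢ† Vᵢ - 2 Vᵢ ρ Vᵢ†)`, with a Hermitian
Hamiltonian `K` and a finite family of jump operators `V`. -/
def IsGKLS {H : Type*} [NormedAddCommGroup H] [InnerProductSpace ℂ H] [CompleteSpace H]
    (L : (H →L[ℂ] H) →L[ℂ] (H →L[ℂ] H)) : Prop :=
  ∃ (K : H →L[ℂ] H) (m : ℕ) (V : Fin m → (H →L[ℂ] H)), IsSelfAdjoint K ∧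
    ∀ ρ : H →L[ℂ] H,
      L ρ = -Complex.I • (K * ρ - ρ * K)
        - (1 / 2 : ℂ) • ∑ i, ((V i)† * V i * ρ + ρ * ((V i)† * V i)
            - (2 : ℂ) • (V i * ρ * (V i)†))

section Spectral

variable {E : Type*} [NormedAddCommGroup E] [NormedSpace ℂ E] [FiniteDimensional ℂ E]

/-- In finite dimension, the generalized eigenspace of `A` at `α` is complementary to the sum of
all the other generalized eigenspaces. -/
theorem isCompl_maxGenEigenspace (A : Module.End ℂ E) (α : ℂ) :
    IsCompl (A.maxGenEigenspace α) (⨆ (β : ℂ) (_ : β ≠ α), A.maxGenEigenspace β) := by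
  refine ⟨A.independent_maxGenEigenspace α, ?_⟩
  rw [codisjoint_iff, eq_top_iff, ← Module.End.iSup_maxGenEigenspace_eq_top A]
  refine iSup_le fun β => ?_
  by_cases h : β = α
  · subst h
    exact le_sup_left
  · exact le_sup_of_le_right (le_iSup₂_of_le β h le_rfl)

/-- The spectral projection of `A` at `α`: the (in general not orthogonal) projection onto the
generalized eigenspace of `A` at `α` along the sum of all the other generalized eigenspaces. -/
def spectralProjection (A : E →L[ℂ] E) (α : ℂ) : E →L[ℂ] E :=
  LinearMap.toContinuousLinearMap
    (Submodule.projection _ _ (isCompl_maxGenEigenspace (A : Module.End ℂ E) α))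

/-- The finite set of the distinct purely imaginary eigenvalues of `A`. -/
def peripheralSpectrum (A : E →L[ℂ] E) : Finset ℂ :=
  ((Module.End.finite_hasEigenvalue (A : Module.End ℂ E)).subset
    (Set.sep_subset _ fun α : ℂ => α.re = 0)).toFinset

/-- The peripheral projection `P_φ` of `A`: the sum of the spectral projections of `A` at its
purely imaginary eigenvalues. -/
def peripheralProjection (A : E →L[ℂ] E) : E →L[ℂ] E :=
  ∑ α ∈ peripheralSpectrum A, spectralProjection A α

/-- The Zeno projection `∑ P_α C P_α` of `C` with respect to `A`, over the purely imaginary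
eigenvalues `α` of `A`. -/
def zenoProjection (A C : E →L[ℂ] E) : E →L[ℂ] E :=
  ∑ α ∈ peripheralSpectrum A, spectralProjection A α * C * spectralProjection A α

end Spectral

/-- `F γ t = O(1/γ)` as `γ → +∞`, uniformly in `t` on every compact subset of `J`. -/
def IsBigOInvUniformlyOnCompacts {E : Type*} [NormedAddCommGroup E]
    (F : ℝ → ℝ → E) (J : Set ℝ) : Prop :=
  ∀ S : Set ℝ, S ⊆ J → IsCompact S →
    ∃ c γ₀ : ℝ, 0 < γ₀ ∧ ∀ γ : ℝ, γ₀ ≤ γ → ∀ t ∈ S, ‖F γ t‖ ≤ c * (1 / γ)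

end

/-! ### Euler's product formula in a Banach algebra -/

section BanachAlgebra

open Filter Topology


/-! GKLS generators form a convex cone, and their exponentials are bounded by a constant depending
only on `dim H` (`IsGKLS.norm_exp_le`). Hence the semigroups of `D` and `γD + L` are bounded
uniformly in `t` and `γ`. Boundedness of `exp (tD)` excludes eigenvalues with positive real part and
makes the imaginary ones semisimple. So `exp (tD) (1 - P_φ)` decays exponentially, `D` commutes with
`L_Z`, and reduced resolvents solve `D X - X D = L P_φ - L_Z` (`exists_commutator_eq`).

The propagators are compared by differentiating `exp ((t-s)(γD+L)) (1 - X/γ) exp (sγD) exp (s L_Z)`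
in `s`. The corrector `X` cancels the order-one term on the peripheral part. What remains is a
bounded term times `1/γ`, plus a term decaying like `exp (-δγs)`, whose integral is also `O(1/γ)`
(`isBigOInv_exp_sub_exp_mul_exp`). The two approximations in the theorem differ by `exp (tγD) (1 -
P_φ)`, which is `O(1/γ)` once `t` stays away from `0`. -/

theorem norm_exp_le_exp_norm {𝔸 : Type*} [NormedRing 𝔸] [NormedAlgebra ℂ 𝔸]
    [NormOneClass 𝔸] [CompleteSpace 𝔸] (a : 𝔸) :
    ‖NormedSpace.exp a‖ ≤ Real.exp ‖a‖ := by
  have h1 := NormedSpace.norm_expSeries_summable' (𝕂 := ℂ) a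
  have h2 : HasSum (fun n : ℕ => ‖a‖ ^ n / n.factorial) (Real.exp ‖a‖) := by
    rw [Real.exp_eq_exp_ℝ]; exact NormedSpace.expSeries_div_hasSum_exp ‖a‖
  rw [NormedSpace.exp_eq_tsum ℂ]
  refine (norm_tsum_le_tsum_norm h1).trans ?_
  rw [← h2.tsum_eq]
  refine h1.tsum_le_tsum (fun n => ?_) h2.summable
  rw [norm_smul, norm_inv, Complex.norm_natCast, div_eq_inv_mul]
  gcongr
  exact norm_pow_le a n

/-- Telescoping. Since `1 ≤ c`, the exponent `n` can replace the sharper `n - 1`. -/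
theorem norm_pow_sub_pow_le {𝔸 : Type*} [NormedRing 𝔸] [NormOneClass 𝔸] {a b : 𝔸} {c : ℝ} (hc : 1 ≤ c) (ha : ‖a‖ ≤ c)
    (hb : ‖b‖ ≤ c) (n : ℕ) : ‖a ^ n - b ^ n‖ ≤ n * c ^ n * ‖a - b‖ := by
  have hc0 : 0 ≤ c := zero_le_one.trans hc
  induction n with
  | zero => simp
  | succ n ih =>
    have h : a ^ (n + 1) - b ^ (n + 1) = a ^ n * (a - b) + (a ^ n - b ^ n) * b := by
      simp only [pow_succ]; noncomm_ring
    rw [h]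
    have h1 : ‖a ^ n * (a - b)‖ ≤ c ^ (n + 1) * ‖a - b‖ := by
      refine (norm_mul_le _ _).trans ?_
      gcongr
      exact (norm_pow_le a n).trans ((pow_le_pow_left₀ (norm_nonneg _) ha n).trans
        (pow_le_pow_right₀ hc n.le_succ))
    have h2 : ‖(a ^ n - b ^ n) * b‖ ≤ n * c ^ n * ‖a - b‖ * c := by
      refine (norm_mul_le _ _).trans ?_
      gcongr
    calc _ ≤ _ := norm_add_le _ _
      _ ≤ c ^ (n + 1) * ‖a - b‖ + n * c ^ n * ‖a - b‖ * c := add_le_add h1 h2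
      _ = _ := by push_cast; ring

/-- Euler's product formula for the exponential, with a perturbation of second order. -/
theorem tendsto_one_add_smul_add_smul_pow_exp {𝔸 : Type*} [NormedRing 𝔸] [NormedAlgebra ℂ 𝔸]
    [NormOneClass 𝔸] [CompleteSpace 𝔸] (a b : 𝔸) :
    Tendsto (fun n : ℕ => (1 + ((n : ℂ)⁻¹) • a + ((n : ℂ)⁻¹) ^ 2 • b) ^ n) atTop
      (𝓝 (NormedSpace.exp a)) := by
  set c := ‖a‖ + ‖b‖
  have hinv : Tendsto (fun n : ℕ => ((n : ℂ)⁻¹)) atTop (𝓝 0) := tendsto_inv_atTop_nhds_zero_nat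
  have hne : Tendsto (fun n : ℕ => ((n : ℂ)⁻¹)) atTop (𝓝[≠] 0) := by
    refine tendsto_nhdsWithin_iff.2 ⟨hinv, ?_⟩
    filter_upwards [eventually_gt_atTop 0] with n hn
    simp [hn.ne']
  have hslope : Tendsto (fun n : ℕ => (n : ℂ) • (NormedSpace.exp (((n : ℂ)⁻¹) • a) - 1)) atTop
      (𝓝 a) := by
    have h := (hasDerivAt_exp_smul_const (𝕂 := ℂ) a 0).tendsto_slope_zero.comp hne
    simpa [Function.comp_def] using h
  -- One step differs from `exp (a/n)` by `o(1/n)`, so `n` steps accumulate an error `o(1)`.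
  have hdiff : Tendsto (fun n : ℕ => (n : ℂ) • ((1 + ((n : ℂ)⁻¹) • a + ((n : ℂ)⁻¹) ^ 2 • b)
      - NormedSpace.exp (((n : ℂ)⁻¹) • a))) atTop (𝓝 0) := by
    have h : Tendsto (fun n : ℕ => a + ((n : ℂ)⁻¹) • b
        - (n : ℂ) • (NormedSpace.exp (((n : ℂ)⁻¹) • a) - 1)) atTop (𝓝 (a + (0 : ℂ) • b - a)) :=
      (tendsto_const_nhds.add (hinv.smul_const b)).sub hslope
    rw [zero_smul, add_zero, sub_self] at h
    refine h.congr' ?_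
    filter_upwards [eventually_gt_atTop 0] with n hn
    have hn' : (n : ℂ) ≠ 0 := by exact_mod_cast hn.ne'
    simp only [smul_sub, smul_add, smul_smul, pow_two]
    rw [mul_inv_cancel₀ hn', mul_inv_cancel_left₀ hn', one_smul]
    abel
  rw [tendsto_iff_norm_sub_tendsto_zero]
  have hlim : Tendsto (fun n : ℕ => Real.exp c * ‖(n : ℂ) • ((1 + ((n : ℂ)⁻¹) • a
      + ((n : ℂ)⁻¹) ^ 2 • b) - NormedSpace.exp (((n : ℂ)⁻¹) • a))‖) atTop (𝓝 0) := by
    simpa using hdiff.norm.const_mul (Real.exp c)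
  refine squeeze_zero' (Eventually.of_forall fun n => norm_nonneg _) ?_ hlim
  filter_upwards [eventually_gt_atTop 0] with n hn
  have hn' : (n : ℂ) ≠ 0 := by exact_mod_cast hn.ne'
  have hn1 : (1 : ℝ) ≤ n := by exact_mod_cast hn
  have hnR : (0 : ℝ) < n := by positivity
  have hexp : NormedSpace.exp (((n : ℂ)⁻¹) • a) ^ n = NormedSpace.exp a := by
    let _ : NormedAlgebra ℚ 𝔸 := .restrictScalars ℚ ℂ 𝔸
    rw [← NormedSpace.exp_nsmul, ← Nat.cast_smul_eq_nsmul ℂ, smul_smul, mul_inv_cancel₀ hn',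
      one_smul]
  -- The common bound `exp (c/n)` is chosen so that its `n`-th power is the constant `exp c`.
  have hA : ‖1 + ((n : ℂ)⁻¹) • a + ((n : ℂ)⁻¹) ^ 2 • b‖ ≤ Real.exp (c / n) := by
    refine le_trans ?_ (Real.add_one_le_exp _)
    refine (norm_add₃_le).trans ?_
    rw [norm_one, norm_smul, norm_smul, norm_pow, norm_inv, Complex.norm_natCast]
    have : ((n : ℝ)⁻¹) ^ 2 ≤ (n : ℝ)⁻¹ := by
      rw [pow_two]; exact mul_le_of_le_one_left (by positivity) (inv_le_one_of_one_le₀ hn1)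
    have := mul_le_mul_of_nonneg_right this (norm_nonneg b)
    rw [div_eq_inv_mul, mul_add]
    linarith
  have hB : ‖NormedSpace.exp (((n : ℂ)⁻¹) • a)‖ ≤ Real.exp (c / n) := by
    refine (norm_exp_le_exp_norm _).trans (Real.exp_le_exp.2 ?_)
    rw [norm_smul, norm_inv, Complex.norm_natCast, div_eq_inv_mul]
    gcongr
    exact le_add_of_nonneg_right (norm_nonneg b)
  have hc1 : 1 ≤ Real.exp (c / n) := Real.one_le_exp (by positivity)
  have key := norm_pow_sub_pow_le hc1 hA hB n
  rw [hexp, ← Real.exp_nat_mul, mul_div_cancel₀ _ hnR.ne'] at key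
  refine key.trans (le_of_eq ?_)
  rw [norm_smul, Complex.norm_natCast]
  ring

end BanachAlgebra

/-! ### Comparison of the propagators -/

section AdiabaticEstimate

open NormedSpace

variable {𝔸 : Type*} [NormedRing 𝔸] [NormedAlgebra ℂ 𝔸] [CompleteSpace 𝔸]

theorem mul_exp_smul_of_mul_eq_zero {q z : 𝔸} (h : q * z = 0) (c : ℂ) : q * exp (c • z) = q := by
  let _ : NormedAlgebra ℚ 𝔸 := .restrictScalars ℚ ℂ 𝔸
  have hs : SemiconjBy q (c • z) 0 := by simp [SemiconjBy, h]
  have h1 : SemiconjBy q (exp (c • z)) 1 := by simpa using hs.exp_right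
  exact h1.eq.trans (one_mul q)

theorem exp_smul_mul_of_mul_eq_zero {q z : 𝔸} (h : z * q = 0) (c : ℂ) : exp (c • z) * q = q := by
  let _ : NormedAlgebra ℚ 𝔸 := .restrictScalars ℚ ℂ 𝔸
  have hs : SemiconjBy q 0 (c • z) := by simp [SemiconjBy, h]
  have h1 : SemiconjBy q 1 (exp (c • z)) := by simpa using hs.exp_right
  exact h1.eq.symm.trans (mul_one q)

theorem hasDerivAt_exp_ofReal_smul (a : 𝔸) (s : ℝ) :
    HasDerivAt (fun s : ℝ => exp ((s : ℂ) • a)) (exp ((s : ℂ) • a) * a) s :=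
  ((hasDerivAt_exp_smul_const (𝕂 := ℂ) a (s : ℂ)).scomp s
    Complex.ofRealCLM.hasDerivAt).congr_deriv (one_smul ℂ _)

theorem hasDerivAt_exp_sub_smul (a : 𝔸) (t s : ℝ) :
    HasDerivAt (fun s : ℝ => exp (((t - s : ℝ) : ℂ) • a)) (-(exp (((t - s : ℝ) : ℂ) • a) * a)) s := by
  exact ((hasDerivAt_exp_ofReal_smul a (t - s)).scomp s
    ((hasDerivAt_id s).const_sub t)).congr_deriv (by simp)

variable {d l z x p : 𝔸} {C K δ : ℝ}

/-- The derivative of the interpolation between the two propagators, corrected at first order by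
the solution `x` of the commutator equation `d x - x d = l p - z`. -/
theorem hasDerivAt_interpolation (hdz : Commute d z) (hdp : Commute d p) (hpz : p * z = z)
    (hx : d * x - x * d = l * p - z) {γ : ℝ} (hγ : γ ≠ 0) (t s : ℝ) :
    HasDerivAt (fun s : ℝ => exp (((t - s : ℝ) : ℂ) • ((γ : ℂ) • d + l)) *
        (1 - (γ : ℂ)⁻¹ • x) * (exp (((s : ℂ) * γ) • d) * exp ((s : ℂ) • z)))
      ((γ : ℂ)⁻¹ • (exp (((t - s : ℝ) : ℂ) • ((γ : ℂ) • d + l)) * (l * x - x * z) *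
          (exp (((s : ℂ) * γ) • d) * exp ((s : ℂ) • z)))
        - exp (((t - s : ℝ) : ℂ) • ((γ : ℂ) • d + l)) * l * (exp (((s : ℂ) * γ) • d) * (1 - p)))
      s := by
  let _ : NormedAlgebra ℚ 𝔸 := .restrictScalars ℚ ℂ 𝔸
  have hγ' : (γ : ℂ) ≠ 0 := by exact_mod_cast hγ
  have hV1 := (hasDerivAt_exp_ofReal_smul ((γ : ℂ) • d) s)
  simp only [smul_smul] at hV1
  have hV := hV1.mul (hasDerivAt_exp_ofReal_smul z s)
  have hF := ((hasDerivAt_exp_sub_smul ((γ : ℂ) • d + l) t s).mul_const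
    (1 - (γ : ℂ)⁻¹ • x)).mul hV
  refine hF.congr_deriv ?_
  have hq : (1 - p) * z = 0 := by rw [sub_mul, one_mul, hpz, sub_self]
  have hqV : exp (((s : ℂ) * γ) • d) * (1 - p)
      = (1 - p) * (exp (((s : ℂ) * γ) • d) * exp ((s : ℂ) • z)) := by
    have hc : Commute (exp (((s : ℂ) * γ) • d)) (1 - p) :=
      ((((Commute.one_right d).sub_right hdp)).smul_left _).exp_left
    rw [← mul_assoc, ← hc.eq, mul_assoc, mul_exp_smul_of_mul_eq_zero hq]
  have hdV : exp (((s : ℂ) * γ) • d) * ((γ : ℂ) • d) * exp ((s : ℂ) • z)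
      + exp (((s : ℂ) * γ) • d) * (exp ((s : ℂ) • z) * z)
      = ((γ : ℂ) • d + z) * (exp (((s : ℂ) * γ) • d) * exp ((s : ℂ) • z)) := by
    have h1 : Commute (exp (((s : ℂ) * γ) • d)) ((γ : ℂ) • d) :=
      (((Commute.refl d).smul_left _).smul_right _).exp_left
    have h2 : Commute (exp ((s : ℂ) • z)) z := ((Commute.refl z).smul_left _).exp_left
    have h3 : Commute (exp (((s : ℂ) * γ) • d)) z := (hdz.smul_left _).exp_left
    rw [h1.eq, h2.eq, ← mul_assoc (exp (((s : ℂ) * γ) • d)), h3.eq, add_mul, mul_assoc, mul_assoc]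
  rw [hqV, hdV, Pi.mul_apply]
  generalize exp (((s : ℂ) * γ) • d) * exp ((s : ℂ) • z) = V
  generalize exp (((t - s : ℝ) : ℂ) • ((γ : ℂ) • d + l)) = U
  -- The terms of order `γ` cancel; at order one, the equation for `x` leaves only `-l (1 - p)`.
  have hY : -(((γ : ℂ) • d + l) * (1 - (γ : ℂ)⁻¹ • x)) + (1 - (γ : ℂ)⁻¹ • x) * ((γ : ℂ) • d + z)
      = (γ : ℂ)⁻¹ • (l * x - x * z) - l * (1 - p) := by
    have h1 : -(((γ : ℂ) • d + l) * (1 - (γ : ℂ)⁻¹ • x))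
        + (1 - (γ : ℂ)⁻¹ • x) * ((γ : ℂ) • d + z)
        = (d * x - x * d) - l + z + (γ : ℂ)⁻¹ • (l * x - x * z) := by
      simp only [mul_sub, add_mul, sub_mul, mul_add, mul_one, one_mul, smul_mul_assoc,
        mul_smul_comm, smul_smul, smul_sub, smul_add, inv_mul_cancel₀ hγ', mul_inv_cancel₀ hγ', one_smul]
      abel
    rw [h1, hx, mul_sub, mul_one]
    abel
  have hE : -(U * ((γ : ℂ) • d + l)) * (1 - (γ : ℂ)⁻¹ • x) * V
      + U * (1 - (γ : ℂ)⁻¹ • x) * (((γ : ℂ) • d + z) * V)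
      = U * (-(((γ : ℂ) • d + l) * (1 - (γ : ℂ)⁻¹ • x))
        + (1 - (γ : ℂ)⁻¹ • x) * ((γ : ℂ) • d + z)) * V := by
    simp only [neg_mul, mul_assoc, mul_add, mul_neg, add_mul]
  rw [hE, hY, mul_sub, sub_mul, mul_smul_comm, smul_mul_assoc]
  simp only [mul_assoc]

/-- Bounds the increment of the interpolation over `[0, t]` by a mean value inequality; the uniform
bound `C` and the decay `hq` control its derivative. -/
theorem isBigOInv_exp_sub_exp_mul_exp (hdz : Commute d z) (hdp : Commute d p) (hpz : p * z = z)
    (hx : d * x - x * d = l * p - z) (hδ : 0 < δ)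
    (hd : ∀ t : ℝ, 0 ≤ t → ‖exp ((t : ℂ) • d)‖ ≤ C)
    (hdl : ∀ γ t : ℝ, 0 ≤ γ → 0 ≤ t → ‖exp ((t : ℂ) • ((γ : ℂ) • d + l))‖ ≤ C)
    (hq : ∀ t : ℝ, 0 ≤ t → ‖exp ((t : ℂ) • d) * (1 - p)‖ ≤ K * Real.exp (-(δ * t))) :
    IsBigOInvUniformlyOnCompacts
      (fun γ t : ℝ => exp ((t : ℂ) • ((γ : ℂ) • d + l))
        - exp (((t : ℂ) * γ) • d) * exp ((t : ℂ) • z)) (Set.Ici 0) := by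
  intro S hS hSc
  obtain ⟨T, hT⟩ := hSc.bddAbove
  have hcont : Continuous fun s : ℝ => exp ((s : ℂ) • z) :=
    continuous_iff_continuousAt.2 fun s => (hasDerivAt_exp_ofReal_smul z s).continuousAt
  obtain ⟨C', hC'⟩ := (isCompact_Icc (a := (0 : ℝ)) (b := T)).exists_bound_of_continuousOn
    hcont.continuousOn
  have hC0 : 0 ≤ C := (norm_nonneg _).trans (hd 0 le_rfl)
  have hK0 : 0 ≤ K := by simpa using (norm_nonneg _).trans (hq 0 le_rfl)
  set A := C * ‖l‖ * K
  set B := C * ‖l * x - x * z‖ * (C * C')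
  -- `A / δ` comes from integrating `A exp (-δγs)`, `B * T` from the term of order `1/γ`, and the
  -- last two summands from the corrector `x` at `s = 0` and `s = t`.
  refine ⟨A / δ + B * T + C * ‖x‖ + ‖x‖ * (C * C'), 1, one_pos, fun γ hγ t ht => ?_⟩
  have hγ0 : 0 < γ := one_pos.trans_le hγ
  have ht0 : 0 ≤ t := hS ht
  have htT : t ≤ T := hT ht
  have hC'0 : 0 ≤ C' := (norm_nonneg _).trans (hC' 0 ⟨le_rfl, ht0.trans htT⟩)
  have hB0 : 0 ≤ B := by positivity
  have hA0 : 0 ≤ A := by positivity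
  have hnγ : ‖(γ : ℂ)⁻¹‖ = γ⁻¹ := by
    rw [norm_inv, Complex.norm_real, Real.norm_of_nonneg hγ0.le]
  have hV : ∀ s ∈ Set.Icc 0 t, ‖exp (((s : ℂ) * γ) • d) * exp ((s : ℂ) • z)‖ ≤ C * C' := by
    intro s hs
    refine (norm_mul_le _ _).trans (mul_le_mul ?_ (hC' s ⟨hs.1, hs.2.trans htT⟩)
      (norm_nonneg _) hC0)
    simpa using hd (s * γ) (mul_nonneg hs.1 hγ0.le)
  set F : ℝ → 𝔸 := fun s => exp (((t - s : ℝ) : ℂ) • ((γ : ℂ) • d + l)) *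
    (1 - (γ : ℂ)⁻¹ • x) * (exp (((s : ℂ) * γ) • d) * exp ((s : ℂ) • z)) with hF
  have hderiv := hasDerivAt_interpolation hdz hdp hpz hx hγ0.ne' t
  have hmv : ‖F t - F 0‖ ≤ A / δ * γ⁻¹ * (1 - Real.exp (-(δ * γ * t))) + B * γ⁻¹ * t := by
    refine image_norm_le_of_norm_deriv_right_le_deriv_boundary (a := 0) (b := t)
      (f := fun s => F s - F 0)
      (B := fun s => A / δ * γ⁻¹ * (1 - Real.exp (-(δ * γ * s))) + B * γ⁻¹ * s)
      (B' := fun s => A * Real.exp (-(δ * γ * s)) + B * γ⁻¹)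
      (fun s _ => ((hderiv s).sub_const (F 0)).continuousAt.continuousWithinAt)
      (fun s _ => ((hderiv s).sub_const (F 0)).hasDerivWithinAt) (by simp) (fun s => ?_)
      (fun s hs => ?_) (Set.right_mem_Icc.2 ht0)
    · have h1 : HasDerivAt (fun s : ℝ => -(δ * γ * s)) (-(δ * γ)) s := by
        exact ((hasDerivAt_id s).const_mul (δ * γ)).neg.congr_deriv (by simp)
      have h2 := ((h1.exp.const_sub 1).const_mul (A / δ * γ⁻¹)).add
        ((hasDerivAt_id s).const_mul (B * γ⁻¹))
      refine h2.congr_deriv ?_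
      field_simp
    · have hU : ‖exp (((t - s : ℝ) : ℂ) • ((γ : ℂ) • d + l))‖ ≤ C :=
        hdl γ (t - s) hγ0.le (sub_nonneg.2 hs.2.le)
      have hQ : ‖exp (((s : ℂ) * γ) • d) * (1 - p)‖ ≤ K * Real.exp (-(δ * γ * s)) := by
        have := hq (s * γ) (mul_nonneg hs.1 hγ0.le)
        rw [show δ * (s * γ) = δ * γ * s by ring] at this
        simpa using this
      refine (norm_sub_le _ _).trans ?_
      rw [add_comm]
      refine add_le_add ?_ ?_
      · refine (norm_mul_le _ _).trans ?_
        calc _ ≤ C * ‖l‖ * (K * Real.exp (-(δ * γ * s))) := by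
              gcongr
              exact (norm_mul_le _ _).trans (by gcongr)
          _ = _ := by ring
      · rw [norm_smul, hnγ, mul_comm]
        gcongr
        refine (norm_mul_le _ _).trans (mul_le_mul ?_ (hV s ⟨hs.1, hs.2.le⟩) (norm_nonneg _)
          (by positivity))
        exact (norm_mul_le _ _).trans (by gcongr)
  have hsplit : exp ((t : ℂ) • ((γ : ℂ) • d + l)) - exp (((t : ℂ) * γ) • d) * exp ((t : ℂ) • z)
      = -(F t - F 0) + (γ : ℂ)⁻¹ • (exp ((t : ℂ) • ((γ : ℂ) • d + l)) * x)
        - (γ : ℂ)⁻¹ • (x * (exp (((t : ℂ) * γ) • d) * exp ((t : ℂ) • z))) := by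
    simp only [hF, sub_self, sub_zero, Complex.ofReal_zero, zero_smul, zero_mul, exp_zero, one_mul,
      mul_one, mul_sub, sub_mul, smul_mul_assoc, mul_smul_comm]
    abel
  have hE : A / δ * γ⁻¹ * (1 - Real.exp (-(δ * γ * t))) ≤ A / δ * γ⁻¹ :=
    mul_le_of_le_one_right (by positivity) (by linarith [Real.exp_pos (-(δ * γ * t))])
  have hBT : B * γ⁻¹ * t ≤ B * γ⁻¹ * T := by gcongr
  have hUx : ‖(γ : ℂ)⁻¹ • (exp ((t : ℂ) • ((γ : ℂ) • d + l)) * x)‖ ≤ γ⁻¹ * (C * ‖x‖) := by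
    rw [norm_smul, hnγ]
    gcongr
    exact (norm_mul_le _ _).trans (by gcongr; exact hdl γ t hγ0.le ht0)
  have hxV : ‖(γ : ℂ)⁻¹ • (x * (exp (((t : ℂ) * γ) • d) * exp ((t : ℂ) • z)))‖
      ≤ γ⁻¹ * (‖x‖ * (C * C')) := by
    rw [norm_smul, hnγ]
    gcongr
    exact (norm_mul_le _ _).trans (by gcongr; exact hV t (Set.right_mem_Icc.2 ht0))
  change ‖_ - _‖ ≤ _
  rw [hsplit]
  calc _ ≤ ‖F t - F 0‖ + γ⁻¹ * (C * ‖x‖) + γ⁻¹ * (‖x‖ * (C * C')) := by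
        refine (norm_sub_le _ _).trans (add_le_add ((norm_add_le _ _).trans
          (add_le_add (by rw [norm_neg]) hUx)) hxV)
    _ ≤ A / δ * γ⁻¹ + B * γ⁻¹ * T + γ⁻¹ * (C * ‖x‖) + γ⁻¹ * (‖x‖ * (C * C')) := by
        linarith
    _ = _ := by rw [one_div]; ring

omit [CompleteSpace 𝔸] in
-- Uses `exp (-y) ≤ 1/y`, and that `t⁻¹` is bounded on compact subsets of `(0, ∞)`.
theorem isBigOInv_exp_mul_one_sub (hδ : 0 < δ)
    (hq : ∀ t : ℝ, 0 ≤ t → ‖exp ((t : ℂ) • d) * (1 - p)‖ ≤ K * Real.exp (-(δ * t))) :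
    IsBigOInvUniformlyOnCompacts (fun γ t : ℝ => exp (((t : ℂ) * γ) • d) * (1 - p))
      (Set.Ioi 0) := by
  intro S hS hSc
  have hK0 : 0 ≤ K := by simpa using (norm_nonneg _).trans (hq 0 le_rfl)
  obtain ⟨c, hc⟩ := hSc.exists_bound_of_continuousOn (f := fun t : ℝ => t⁻¹)
    (continuousOn_id.inv₀ fun t ht => (hS ht).ne')
  refine ⟨K / δ * c, 1, one_pos, fun γ hγ t ht => ?_⟩
  have hγ0 : 0 < γ := one_pos.trans_le hγ
  have ht0 : 0 < t := hS ht
  have h1 := hq (t * γ) (by positivity)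
  rw [Complex.ofReal_mul] at h1
  refine h1.trans ?_
  have h2 : Real.exp (-(δ * (t * γ))) ≤ (δ * (t * γ))⁻¹ := by
    rw [Real.exp_neg]
    exact inv_anti₀ (by positivity) ((le_add_of_nonneg_right zero_le_one).trans
      (Real.add_one_le_exp _))
  have h3 : t⁻¹ ≤ c := (Real.le_norm_self _).trans (hc t ht)
  calc K * Real.exp (-(δ * (t * γ))) ≤ K * (δ * (t * γ))⁻¹ := by gcongr
    _ = K / δ * t⁻¹ * (1 / γ) := by field_simp
    _ ≤ K / δ * c * (1 / γ) := by gcongr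

theorem IsBigOInvUniformlyOnCompacts.mono {E : Type*} [NormedAddCommGroup E] {F : ℝ → ℝ → E}
    {J J' : Set ℝ} (h : IsBigOInvUniformlyOnCompacts F J) (hJ : J' ⊆ J) :
    IsBigOInvUniformlyOnCompacts F J' :=
  fun S hS hSc => h S (hS.trans hJ) hSc

theorem IsBigOInvUniformlyOnCompacts.add {E : Type*} [NormedAddCommGroup E] {F G : ℝ → ℝ → E}
    {J : Set ℝ} (hF : IsBigOInvUniformlyOnCompacts F J) (hG : IsBigOInvUniformlyOnCompacts G J) :
    IsBigOInvUniformlyOnCompacts (fun γ t => F γ t + G γ t) J := by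
  intro S hS hSc
  obtain ⟨c, γ₀, h0, hc⟩ := hF S hS hSc
  obtain ⟨c', γ₁, _, hc'⟩ := hG S hS hSc
  refine ⟨c + c', max γ₀ γ₁, lt_max_of_lt_left h0, fun γ hγ t ht => ?_⟩
  rw [add_mul]
  exact (norm_add_le _ _).trans (add_le_add (hc γ (le_of_max_le_left hγ) t ht)
    (hc' γ (le_of_max_le_right hγ) t ht))

end AdiabaticEstimate

/-! ### Uniform bounds for GKLS semigroups -/

section TraceBound

open Filter Topology

variable {H : Type*} [NormedAddCommGroup H] [InnerProductSpace ℂ H]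

/-- The trace of a bounded operator, as a linear functional. -/
noncomputable def operatorTrace : (H →L[ℂ] H) →ₗ[ℂ] ℂ :=
  LinearMap.trace ℂ H ∘ₗ ContinuousLinearMap.coeLM ℂ

theorem operatorTrace_mul_comm (A B : H →L[ℂ] H) :
    operatorTrace (A * B) = operatorTrace (B * A) :=
  LinearMap.trace_mul_comm ℂ (A : H →ₗ[ℂ] H) (B : H →ₗ[ℂ] H)

variable [FiniteDimensional ℂ H]

theorem operatorTrace_eq_sum_inner (A : H →L[ℂ] H) :
    operatorTrace A = ∑ i, inner ℂ (stdOrthonormalBasis ℂ H i) (A (stdOrthonormalBasis ℂ H i)) :=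
  LinearMap.trace_eq_sum_inner (A : H →ₗ[ℂ] H) (stdOrthonormalBasis ℂ H)

theorem norm_operatorTrace_le (A : H →L[ℂ] H) :
    ‖operatorTrace A‖ ≤ Module.finrank ℂ H * ‖A‖ := by
  rw [operatorTrace_eq_sum_inner]
  refine (norm_sum_le_of_le (f := fun i => inner ℂ (stdOrthonormalBasis ℂ H i)
    (A (stdOrthonormalBasis ℂ H i))) Finset.univ (n := fun _ => ‖A‖) fun i _ => ?_).trans
    (by simp)
  refine (norm_inner_le_norm _ _).trans ?_
  simpa using A.le_opNorm (stdOrthonormalBasis ℂ H i)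

/-- The Hilbert–Schmidt norm dominates the operator norm, by Cauchy–Schwarz on basis coefficients.
-/
theorem norm_sq_le_sum_norm_sq (B : H →L[ℂ] H) :
    ‖B‖ ^ 2 ≤ ∑ i, ‖B (stdOrthonormalBasis ℂ H i)‖ ^ 2 := by
  set e := stdOrthonormalBasis ℂ H
  have h0 : 0 ≤ ∑ i, ‖B (e i)‖ ^ 2 := Finset.sum_nonneg fun i _ => by positivity
  rw [← Real.le_sqrt (norm_nonneg _) h0]
  refine B.opNorm_le_bound (Real.sqrt_nonneg _) fun x => ?_
  have hx : B x = ∑ i, inner ℂ (e i) x • B (e i) := by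
    conv_lhs => rw [← e.sum_repr' x]
    simp
  rw [hx]
  refine (norm_sum_le _ _).trans ?_
  simp only [norm_smul]
  refine (Real.sum_mul_le_sqrt_mul_sqrt _ _ _).trans ?_
  rw [e.sum_sq_norm_inner_right x, Real.sqrt_sq (norm_nonneg _), mul_comm]

variable [CompleteSpace H]

theorem norm_le_re_operatorTrace {A : H →L[ℂ] H} (hA : 0 ≤ A) : ‖A‖ ≤ (operatorTrace A).re := by
  obtain ⟨B, rfl⟩ := CStarAlgebra.nonneg_iff_eq_star_mul_self.1 hA
  rw [CStarRing.norm_star_mul_self, ← pow_two]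
  refine (norm_sq_le_sum_norm_sq B).trans (le_of_eq ?_)
  rw [operatorTrace_eq_sum_inner, Complex.re_sum]
  refine Finset.sum_congr rfl fun i _ => ?_
  rw [mul_apply_eq_comp, ContinuousLinearMap.star_eq_adjoint,
    ContinuousLinearMap.adjoint_inner_right, inner_self_eq_norm_sq_to_K]
  norm_cast

omit [FiniteDimensional ℂ H] in
theorem ofReal_smul_operator_nonneg {A : H →L[ℂ] H} (hA : 0 ≤ A) {r : ℝ} (hr : 0 ≤ r) :
    0 ≤ (r : ℂ) • A := by
  rw [Complex.coe_smul]
  exact smul_nonneg hr hA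

omit [FiniteDimensional ℂ H] in
/-- A GKLS generator is a sum of a completely positive map and a map `ρ ↦ Gρ + ρG†`. -/
theorem IsGKLS.exists_eq_add_sum {D : (H →L[ℂ] H) →L[ℂ] (H →L[ℂ] H)} (hD : IsGKLS D) :
    ∃ (G : H →L[ℂ] H) (m : ℕ) (V : Fin m → (H →L[ℂ] H)),
      (∀ ρ, D ρ = G * ρ + ρ * star G + ∑ i, V i * ρ * star (V i)) ∧
        G + star G + ∑ i, star (V i) * V i = 0 := by
  obtain ⟨K, m, V, hK, hD⟩ := hD
  have hW : star (∑ i, star (V i) * V i) = ∑ i, star (V i) * V i := by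
    simp [star_sum]
  have hG : star (-Complex.I • K - (1 / 2 : ℂ) • ∑ i, star (V i) * V i)
      = Complex.I • K - (1 / 2 : ℂ) • ∑ i, star (V i) * V i := by
    rw [star_sub, star_smul, star_smul, hW, hK.star_eq]
    simp
  -- `G` is the effective non-Hermitian Hamiltonian; the second identity encodes trace preservation.
  refine ⟨-Complex.I • K - (1 / 2 : ℂ) • ∑ i, star (V i) * V i, m, V, fun ρ => ?_, ?_⟩
  · rw [hD, hG]
    simp only [← ContinuousLinearMap.star_eq_adjoint, Finset.sum_sub_distrib,
      Finset.sum_add_distrib, ← Finset.smul_sum, ← Finset.sum_mul, ← Finset.mul_sum]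
    simp only [sub_mul, mul_sub, smul_mul_assoc, mul_smul_comm, smul_sub, smul_add, smul_smul]
    module
  · rw [hG]
    module

/-- First order steps along a GKLS generator preserve positivity, up to a second order
correction. -/
theorem IsGKLS.exists_positive_step {D : (H →L[ℂ] H) →L[ℂ] (H →L[ℂ] H)} (hD : IsGKLS D) :
    ∃ (R : (H →L[ℂ] H) →L[ℂ] (H →L[ℂ] H)) (c : ℝ), 0 ≤ c ∧ ∀ (h : ℝ), 0 ≤ h →
      ∀ ρ : H →L[ℂ] H, 0 ≤ ρ → 0 ≤ (1 + (h : ℂ) • D + (h : ℂ) ^ 2 • R) ρ ∧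
        (operatorTrace ((1 + (h : ℂ) • D + (h : ℂ) ^ 2 • R) ρ)).re
          ≤ (1 + c * h ^ 2) * (operatorTrace ρ).re := by
  obtain ⟨G, m, V, hDρ, hG⟩ := hD.exists_eq_add_sum
  -- The term `h² GρG†` completes `ρ + h(Gρ + ρG†)` to the positive expression `(1 + hG) ρ (1 +
  -- hG)†`.
  set R : (H →L[ℂ] H) →L[ℂ] (H →L[ℂ] H) :=
    (ContinuousLinearMap.mul ℂ (H →L[ℂ] H) G).comp
      ((ContinuousLinearMap.mul ℂ (H →L[ℂ] H)).flip (star G))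
  have hR : ∀ ρ, R ρ = G * (ρ * star G) := fun ρ => rfl
  have htr : ∀ ρ, operatorTrace (D ρ) = 0 := by
    intro ρ
    have h1 : operatorTrace (D ρ) = operatorTrace ((G + star G + ∑ i, star (V i) * V i) * ρ) := by
      rw [hDρ, add_mul, add_mul, Finset.sum_mul]
      simp only [map_add, map_sum]
      rw [operatorTrace_mul_comm ρ]
      congr 1
      refine Finset.sum_congr rfl fun i _ => ?_
      rw [operatorTrace_mul_comm, mul_assoc]
    rw [h1, hG, zero_mul, map_zero]
  refine ⟨R, Module.finrank ℂ H * ‖R‖, by positivity, fun h hh ρ hρ => ⟨?_, ?_⟩⟩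
  · have h1 : (1 + (h : ℂ) • D + (h : ℂ) ^ 2 • R) ρ
        = (1 + (h : ℂ) • G) * ρ * star (1 + (h : ℂ) • G)
          + (h : ℂ) • ∑ i, V i * ρ * star (V i) := by
      change ρ + (h : ℂ) • D ρ + (h : ℂ) ^ 2 • R ρ = _
      rw [hDρ, hR, star_add, star_one, star_smul]
      simp only [Complex.star_def, Complex.conj_ofReal, add_mul, mul_add, one_mul, mul_one,
        smul_mul_assoc, mul_smul_comm, smul_add, smul_smul, mul_assoc]
      module
    rw [h1]
    refine add_nonneg (star_right_conjugate_nonneg hρ _) (ofReal_smul_operator_nonneg ?_ hh)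
    exact Finset.sum_nonneg fun i _ => star_right_conjugate_nonneg hρ _
  · have h1 : operatorTrace ((1 + (h : ℂ) • D + (h : ℂ) ^ 2 • R) ρ)
        = operatorTrace ρ + (h : ℂ) ^ 2 * operatorTrace (R ρ) := by
      change operatorTrace (ρ + (h : ℂ) • D ρ + (h : ℂ) ^ 2 • R ρ) = _
      rw [map_add, map_add, map_smul, map_smul, htr, smul_zero, add_zero, smul_eq_mul]
    have h2 : (operatorTrace (R ρ)).re ≤ Module.finrank ℂ H * ‖R‖ * (operatorTrace ρ).re :=
      calc _ ≤ ‖operatorTrace (R ρ)‖ := Complex.re_le_norm _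
        _ ≤ Module.finrank ℂ H * ‖R ρ‖ := norm_operatorTrace_le _
        _ ≤ Module.finrank ℂ H * (‖R‖ * (operatorTrace ρ).re) := by
          gcongr
          exact (R.le_opNorm ρ).trans (by gcongr; exact norm_le_re_operatorTrace hρ)
        _ = _ := by ring
    have h3 := mul_le_mul_of_nonneg_left h2 (sq_nonneg h)
    rw [h1, Complex.add_re, ← Complex.ofReal_pow, Complex.re_ofReal_mul]
    linarith

/-- `exp D` is the limit of `n` positive steps of length `1/n`. Each multiplies the trace by at most
`1 + c/n²`, all together by at most `exp (c/n) → 1`, and the trace dominates the norm on positive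
operators. -/
theorem IsGKLS.norm_exp_apply_le_of_nonneg [Nontrivial H]
    {D : (H →L[ℂ] H) →L[ℂ] (H →L[ℂ] H)} (hD : IsGKLS D) {ρ : H →L[ℂ] H} (hρ : 0 ≤ ρ) :
    ‖NormedSpace.exp D ρ‖ ≤ (operatorTrace ρ).re := by
  obtain ⟨R, c, hc, hstep⟩ := hD.exists_positive_step
  have hlim := tendsto_one_add_smul_add_smul_pow_exp D R
  have hlim' : Tendsto (fun n : ℕ => ‖((1 + ((n : ℂ)⁻¹) • D + ((n : ℂ)⁻¹) ^ 2 • R) ^ n) ρ‖) atTop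
      (𝓝 ‖NormedSpace.exp D ρ‖) :=
    (((ContinuousLinearMap.apply ℂ (H →L[ℂ] H) ρ).continuous.tendsto _).comp hlim).norm
  have hbound : Tendsto (fun n : ℕ => Real.exp (c * (n : ℝ)⁻¹) * (operatorTrace ρ).re) atTop
      (𝓝 (operatorTrace ρ).re) := by
    have h := ((tendsto_inv_atTop_nhds_zero_nat (𝕜 := ℝ)).const_mul c).rexp.mul_const
      (operatorTrace ρ).re
    simpa using h
  refine le_of_tendsto_of_tendsto hlim' hbound ?_
  filter_upwards [eventually_gt_atTop 0] with n hn
  have hh : (0 : ℝ) ≤ (n : ℝ)⁻¹ := by positivity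
  have hpow : ∀ k : ℕ, 0 ≤ ((1 + ((n : ℂ)⁻¹) • D + ((n : ℂ)⁻¹) ^ 2 • R) ^ k) ρ ∧
      (operatorTrace (((1 + ((n : ℂ)⁻¹) • D + ((n : ℂ)⁻¹) ^ 2 • R) ^ k) ρ)).re
        ≤ (1 + c * ((n : ℝ)⁻¹) ^ 2) ^ k * (operatorTrace ρ).re := by
    intro k
    induction k with
    | zero => simp [hρ]
    | succ k ih =>
      have h := hstep _ hh _ ih.1
      rw [Complex.ofReal_inv, Complex.ofReal_natCast] at h
      rw [pow_succ', mul_apply_eq_comp]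
      refine ⟨h.1, h.2.trans ?_⟩
      rw [pow_succ' (1 + _), mul_assoc]
      exact mul_le_mul_of_nonneg_left ih.2 (by positivity)
  refine (norm_le_re_operatorTrace (hpow n).1).trans ((hpow n).2.trans ?_)
  refine mul_le_mul_of_nonneg_right ?_ ((norm_nonneg _).trans (norm_le_re_operatorTrace hρ))
  have h1 : 1 + c * ((n : ℝ)⁻¹) ^ 2 ≤ Real.exp (c * ((n : ℝ)⁻¹) ^ 2) := by
    rw [add_comm]; exact Real.add_one_le_exp _
  refine (pow_le_pow_left₀ (by positivity) h1 n).trans (le_of_eq ?_)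
  rw [← Real.exp_nat_mul]
  congr 1
  have : (n : ℝ) ≠ 0 := by positivity
  field_simp

/-- Any operator is a combination, with coefficients powers of `i`, of four positive operators of no
larger norm. -/
theorem IsGKLS.norm_exp_le {D : (H →L[ℂ] H) →L[ℂ] (H →L[ℂ] H)} (hD : IsGKLS D) :
    ‖NormedSpace.exp D‖ ≤ 4 * Module.finrank ℂ H := by
  rcases subsingleton_or_nontrivial H with hH | hH
  · have : NormedSpace.exp D = 0 := Subsingleton.elim _ _
    rw [this, norm_zero]
    positivity
  refine ContinuousLinearMap.opNorm_le_bound _ (by positivity) fun ρ => ?_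
  obtain ⟨x, hx0, hxn, hx⟩ := CStarAlgebra.exists_sum_four_nonneg ρ
  have h1 : ∀ i, ‖NormedSpace.exp D (x i)‖ ≤ Module.finrank ℂ H * ‖ρ‖ := fun i =>
    (hD.norm_exp_apply_le_of_nonneg (hx0 i)).trans ((Complex.re_le_norm _).trans
      ((norm_operatorTrace_le _).trans (by gcongr; exact hxn i)))
  conv_lhs => rw [hx]
  rw [map_sum]
  refine (norm_sum_le_of_le Finset.univ (n := fun _ => Module.finrank ℂ H * ‖ρ‖)
    fun i _ => ?_).trans (le_of_eq ?_)
  · rw [map_smul, norm_smul, norm_pow, Complex.norm_I, one_pow, one_mul]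
    exact h1 i
  · simp [mul_assoc]

omit [FiniteDimensional ℂ H] in
theorem IsGKLS.add {D L : (H →L[ℂ] H) →L[ℂ] (H →L[ℂ] H)} (hD : IsGKLS D) (hL : IsGKLS L) :
    IsGKLS (D + L) := by
  obtain ⟨K, m, V, hK, hD⟩ := hD
  obtain ⟨K', m', V', hK', hL⟩ := hL
  refine ⟨K + K', m + m', Fin.append V V', hK.add hK', fun ρ => ?_⟩
  rw [add_apply, hD, hL, Fin.sum_univ_add]
  simp only [Fin.append_left, Fin.append_right, add_mul, mul_add]
  module

omit [FiniteDimensional ℂ H] in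
-- Jump operators scale by `√r`. This absorbs times and couplings into the generator, so the bound
-- on `exp D` covers whole semigroups.
theorem IsGKLS.smul {D : (H →L[ℂ] H) →L[ℂ] (H →L[ℂ] H)} (hD : IsGKLS D) {r : ℝ} (hr : 0 ≤ r) :
    IsGKLS ((r : ℂ) • D) := by
  obtain ⟨K, m, V, hK, hD⟩ := hD
  have hs : (Real.sqrt r : ℂ) * (Real.sqrt r : ℂ) = r := by
    rw [← Complex.ofReal_mul, Real.mul_self_sqrt hr]
  have hstar : ∀ i, ((Real.sqrt r : ℂ) • V i)† = (Real.sqrt r : ℂ) • (V i)† := fun i => by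
    rw [← ContinuousLinearMap.star_eq_adjoint, star_smul, ContinuousLinearMap.star_eq_adjoint]
    simp
  refine ⟨(r : ℂ) • K, m, fun i => (Real.sqrt r : ℂ) • V i, ?_, fun ρ => ?_⟩
  · rw [Complex.coe_smul]
    exact IsSelfAdjoint.smul (IsSelfAdjoint.all r) hK
  · rw [smul_apply, hD]
    simp only [hstar, smul_mul_assoc, mul_smul_comm, smul_smul, hs]
    rw [smul_sub]
    congr 1
    · module
    · rw [smul_smul, mul_comm, ← smul_smul, Finset.smul_sum]
      congr 1
      refine Finset.sum_congr rfl fun i _ => ?_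
      module

end TraceBound

/-! ### Growth and decay on generalized eigenspaces -/

section GeneralizedEigenvectors

open NormedSpace

variable {𝔸 : Type*} [NormedRing 𝔸] [NormedAlgebra ℂ 𝔸] [CompleteSpace 𝔸]

/-- The exponential on a generalized eigenspace is polynomial up to a scalar exponential. -/
theorem exp_smul_mul_eq_sum {a p : 𝔸} {α : ℂ} {n : ℕ}
    (h : (a - algebraMap ℂ 𝔸 α) ^ n * p = 0) (t : ℂ) :
    exp (t • a) * p = Complex.exp (t * α) • ∑ j ∈ Finset.range n,
      (((j.factorial : ℂ)⁻¹) * t ^ j) • ((a - algebraMap ℂ 𝔸 α) ^ j * p) := by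
  let _ : NormedAlgebra ℚ 𝔸 := .restrictScalars ℚ ℂ 𝔸
  have h1 : exp (t • a) = Complex.exp (t * α) • exp (t • (a - algebraMap ℂ 𝔸 α)) := by
    have h2 : t • a = algebraMap ℂ 𝔸 (t * α) + t • (a - algebraMap ℂ 𝔸 α) := by
      rw [map_mul, ← Algebra.smul_def, smul_sub]; abel
    conv_lhs => rw [h2]
    rw [exp_add_of_commute (Algebra.commutes _ _), ← algebraMap_exp_comm, ← Complex.exp_eq_exp_ℂ,
      ← Algebra.smul_def]
  rw [h1, smul_mul_assoc]
  congr 1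
  have h3 := (exp_series_hasSum_exp' (𝕂 := ℂ) (t • (a - algebraMap ℂ 𝔸 α))).mul_right p
  have h4 : ∀ j : ℕ, ((j.factorial : ℂ)⁻¹ • (t • (a - algebraMap ℂ 𝔸 α)) ^ j) * p
      = (((j.factorial : ℂ)⁻¹) * t ^ j) • ((a - algebraMap ℂ 𝔸 α) ^ j * p) := fun j => by
    rw [smul_pow, smul_smul, smul_mul_assoc]
  simp only [h4] at h3
  refine h3.unique (hasSum_sum_of_ne_finset_zero fun j hj => ?_)
  rw [Finset.mem_range, not_lt] at hj
  obtain ⟨k, rfl⟩ := Nat.exists_eq_add_of_le' hj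
  rw [pow_add (a - _), mul_assoc (_ ^ k), h, mul_zero, smul_zero]

theorem norm_exp_ofReal_mul (t : ℝ) (α : ℂ) :
    ‖Complex.exp ((t : ℂ) * α)‖ = Real.exp (t * α.re) := by
  rw [Complex.norm_exp, Complex.re_ofReal_mul]

theorem exists_norm_exp_smul_mul_le {a p : 𝔸} {α : ℂ} {n : ℕ}
    (h : (a - algebraMap ℂ 𝔸 α) ^ n * p = 0) (hα : α.re < 0) :
    ∃ K δ : ℝ, 0 < δ ∧ ∀ t : ℝ, 0 ≤ t → ‖exp ((t : ℂ) • a) * p‖ ≤ K * Real.exp (-(δ * t)) := by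
  -- Half of the decay rate is kept; the other half absorbs the polynomial factors.
  set δ := -α.re / 2 with hδdef
  have hδ : 0 < δ := by linarith
  refine ⟨∑ j ∈ Finset.range n, (δ⁻¹) ^ j * ‖(a - algebraMap ℂ 𝔸 α) ^ j * p‖, δ, hδ,
    fun t ht => ?_⟩
  rw [exp_smul_mul_eq_sum h, norm_smul, norm_exp_ofReal_mul]
  have h1 : ‖∑ j ∈ Finset.range n,
      (((j.factorial : ℂ)⁻¹) * (t : ℂ) ^ j) • ((a - algebraMap ℂ 𝔸 α) ^ j * p)‖
      ≤ (∑ j ∈ Finset.range n, (δ⁻¹) ^ j * ‖(a - algebraMap ℂ 𝔸 α) ^ j * p‖)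
        * Real.exp (δ * t) := by
    rw [Finset.sum_mul]
    refine norm_sum_le_of_le _ fun j _ => ?_
    rw [norm_smul, norm_mul, norm_inv, Complex.norm_natCast, norm_pow, Complex.norm_real,
      Real.norm_of_nonneg ht]
    have h2 : (j.factorial : ℝ)⁻¹ * t ^ j ≤ (δ⁻¹) ^ j * Real.exp (δ * t) := by
      have h3 := Real.pow_div_factorial_le_exp _ (mul_nonneg hδ.le ht) j
      calc (j.factorial : ℝ)⁻¹ * t ^ j = (δ⁻¹) ^ j * ((δ * t) ^ j / j.factorial) := by
            rw [mul_pow, inv_pow]; field_simp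
        _ ≤ _ := by gcongr
    calc _ ≤ (δ⁻¹) ^ j * Real.exp (δ * t) * ‖(a - algebraMap ℂ 𝔸 α) ^ j * p‖ := by gcongr
      _ = _ := by ring
  calc _ ≤ Real.exp (t * α.re) * ((∑ j ∈ Finset.range n,
        (δ⁻¹) ^ j * ‖(a - algebraMap ℂ 𝔸 α) ^ j * p‖) * Real.exp (δ * t)) := by gcongr
    _ = (∑ j ∈ Finset.range n, (δ⁻¹) ^ j * ‖(a - algebraMap ℂ 𝔸 α) ^ j * p‖)
        * (Real.exp (t * α.re) * Real.exp (δ * t)) := by ring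
    _ = _ := by
      rw [← Real.exp_add, show t * α.re + δ * t = -(δ * t) by rw [hδdef]; ring]

/-- Induction reduces to `(a - α) p = 0`, where a nonzero `p` would make the semigroup grow
exponentially. -/
theorem eq_zero_of_sub_pow_mul_eq_zero_of_re_pos {a p : 𝔸} {α : ℂ} {C : ℝ}
    (ha : ∀ t : ℝ, 0 ≤ t → ‖exp ((t : ℂ) • a)‖ ≤ C) (hα : 0 < α.re) {n : ℕ}
    (h : (a - algebraMap ℂ 𝔸 α) ^ n * p = 0) : p = 0 := by
  induction n generalizing p with
  | zero => simpa using h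
  | succ n ih =>
    rw [pow_succ, mul_assoc] at h
    have h1 := ih h
    by_contra hp
    have hp' : 0 < ‖p‖ := norm_pos_iff.2 hp
    have h2 : ∀ t : ℝ, 0 ≤ t → t * α.re + 1 ≤ C := fun t ht => by
      have h3 := exp_smul_mul_eq_sum (n := 1) (by rwa [pow_one]) (t : ℂ) (p := p) (a := a) (α := α)
      have h4 : ‖exp ((t : ℂ) • a) * p‖ = Real.exp (t * α.re) * ‖p‖ := by
        rw [h3, norm_smul, norm_exp_ofReal_mul]; simp
      have h5 : Real.exp (t * α.re) * ‖p‖ ≤ C * ‖p‖ := by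
        rw [← h4]
        exact (norm_mul_le _ _).trans (by gcongr; exact ha t ht)
      exact (Real.add_one_le_exp _).trans (le_of_mul_le_mul_right h5 hp')
    have hC : 0 ≤ C := (norm_nonneg _).trans (ha 0 le_rfl)
    have h6 := h2 (C / α.re) (by positivity)
    rw [div_mul_cancel₀ _ hα.ne'] at h6
    linarith

/-- Induction reduces to `n = 2`, where a nontrivial Jordan block would force linear growth in `t`.
-/
theorem sub_mul_eq_zero_of_sub_pow_mul_eq_zero {a p : 𝔸} {α : ℂ} {C : ℝ}
    (ha : ∀ t : ℝ, 0 ≤ t → ‖exp ((t : ℂ) • a)‖ ≤ C) (hα : α.re = 0) {n : ℕ}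
    (h : (a - algebraMap ℂ 𝔸 α) ^ n * p = 0) : (a - algebraMap ℂ 𝔸 α) * p = 0 := by
  induction n generalizing p with
  | zero =>
    have hp : p = 0 := by simpa using h
    rw [hp, mul_zero]
  | succ n ih =>
    rw [pow_succ, mul_assoc] at h
    have h1 := ih h
    by_contra hp
    have hp' : 0 < ‖(a - algebraMap ℂ 𝔸 α) * p‖ := norm_pos_iff.2 hp
    have h2 : ∀ t : ℝ, 0 ≤ t → t * ‖(a - algebraMap ℂ 𝔸 α) * p‖ ≤ C * ‖p‖ + ‖p‖ := fun t ht => by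
      have h3 := exp_smul_mul_eq_sum (n := 2) (by rwa [pow_two, mul_assoc]) (t : ℂ) (p := p)
        (a := a) (α := α)
      have h4 : ‖exp ((t : ℂ) • a) * p‖ = ‖p + (t : ℂ) • ((a - algebraMap ℂ 𝔸 α) * p)‖ := by
        rw [h3, norm_smul, norm_exp_ofReal_mul, hα, mul_zero, Real.exp_zero, one_mul]
        simp [Finset.sum_range_succ]
      have h5 : ‖p + (t : ℂ) • ((a - algebraMap ℂ 𝔸 α) * p)‖ ≤ C * ‖p‖ := by
        rw [← h4]
        exact (norm_mul_le _ _).trans (by gcongr; exact ha t ht)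
      have h6 : ‖(t : ℂ) • ((a - algebraMap ℂ 𝔸 α) * p)‖
          = t * ‖(a - algebraMap ℂ 𝔸 α) * p‖ := by
        rw [norm_smul, Complex.norm_real, Real.norm_of_nonneg ht]
      have h7 := norm_sub_le (p + (t : ℂ) • ((a - algebraMap ℂ 𝔸 α) * p)) p
      rw [add_sub_cancel_left, h6] at h7
      linarith
    have hC : 0 ≤ C := (norm_nonneg _).trans (ha 0 le_rfl)
    have h8 := h2 ((C * ‖p‖ + ‖p‖ + 1) / ‖(a - algebraMap ℂ 𝔸 α) * p‖) (by positivity)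
    rw [div_mul_cancel₀ _ hp'.ne'] at h8
    linarith

omit [CompleteSpace 𝔸] in
theorem exists_norm_exp_smul_mul_sum_le {ι : Type*} {a : 𝔸} {p : ι → 𝔸} (s : Finset ι)
    (h : ∀ i ∈ s, ∃ K δ : ℝ, 0 < δ ∧
      ∀ t : ℝ, 0 ≤ t → ‖exp ((t : ℂ) • a) * p i‖ ≤ K * Real.exp (-(δ * t))) :
    ∃ K δ : ℝ, 0 < δ ∧
      ∀ t : ℝ, 0 ≤ t → ‖exp ((t : ℂ) • a) * ∑ i ∈ s, p i‖ ≤ K * Real.exp (-(δ * t)) := by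
  classical
  induction s using Finset.induction_on with
  | empty => exact ⟨0, 1, one_pos, fun t _ => by simp⟩
  | insert i s hi ih =>
    obtain ⟨K₁, δ₁, hδ₁, h₁⟩ := h i (Finset.mem_insert_self i s)
    obtain ⟨K₂, δ₂, hδ₂, h₂⟩ := ih fun j hj => h j (Finset.mem_insert_of_mem hj)
    have hK₁ : 0 ≤ K₁ := by simpa using (norm_nonneg _).trans (h₁ 0 le_rfl)
    have hK₂ : 0 ≤ K₂ := by simpa using (norm_nonneg _).trans (h₂ 0 le_rfl)
    refine ⟨K₁ + K₂, min δ₁ δ₂, lt_min hδ₁ hδ₂, fun t ht => ?_⟩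
    rw [Finset.sum_insert hi, mul_add, add_mul]
    refine (norm_add_le _ _).trans (add_le_add ((h₁ t ht).trans ?_) ((h₂ t ht).trans ?_))
    · gcongr; exact min_le_left _ _
    · gcongr; exact min_le_right _ _

end GeneralizedEigenvectors

/-! ### Spectral projections and the commutator equation -/

section SpectralProjections

variable {E : Type*} [NormedAddCommGroup E] [NormedSpace ℂ E] [FiniteDimensional ℂ E]
  (A : E →L[ℂ] E)

theorem spectralProjection_apply_mem (α : ℂ) (x : E) :
    spectralProjection A α x ∈ Module.End.maxGenEigenspace (A : Module.End ℂ E) α :=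
  Submodule.projection_apply_mem (isCompl_maxGenEigenspace (A : Module.End ℂ E) α) x

variable {A} in
theorem spectralProjection_apply_of_mem {α : ℂ} {x : E}
    (hx : x ∈ Module.End.maxGenEigenspace (A : Module.End ℂ E) α) : spectralProjection A α x = x :=
  Submodule.projection_apply_of_mem_left (isCompl_maxGenEigenspace (A : Module.End ℂ E) α) hx

variable {A} in
theorem spectralProjection_apply_of_mem_of_ne {α β : ℂ} (h : β ≠ α) {x : E}
    (hx : x ∈ Module.End.maxGenEigenspace (A : Module.End ℂ E) β) : spectralProjection A α x = 0 :=
  (Submodule.projection_apply_eq_zero_iff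
    (isCompl_maxGenEigenspace (A : Module.End ℂ E) α)).2
    ((le_iSup₂_of_le (f := fun (β : ℂ) (_ : β ≠ α) => Module.End.maxGenEigenspace (A : Module.End ℂ E) β)
      β h le_rfl) hx)

variable {A} in
theorem ext_on_maxGenEigenspace {S T : E →L[ℂ] E}
    (h : ∀ β, ∀ x ∈ Module.End.maxGenEigenspace (A : Module.End ℂ E) β, S x = T x) : S = T := by
  ext x
  have hx : x ∈ ⨆ β, Module.End.maxGenEigenspace (A : Module.End ℂ E) β := by
    rw [Module.End.iSup_maxGenEigenspace_eq_top]; trivial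
  induction hx using Submodule.iSup_induction' with
  | mem β x hx => exact h β x hx
  | zero => simp
  | add x y _ _ hx hy => rw [map_add, map_add, hx, hy]

omit [FiniteDimensional ℂ E] in
variable {A} in
theorem apply_mem_maxGenEigenspace {α : ℂ} {x : E}
    (hx : x ∈ Module.End.maxGenEigenspace (A : Module.End ℂ E) α) :
    A x ∈ Module.End.maxGenEigenspace (A : Module.End ℂ E) α :=
  Module.End.mapsTo_maxGenEigenspace_of_comm (Commute.refl (A : Module.End ℂ E)) α hx

theorem commute_spectralProjection (α : ℂ) : Commute A (spectralProjection A α) := by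
  refine ext_on_maxGenEigenspace (A := A) fun β x hx => ?_
  change A (spectralProjection A α x) = spectralProjection A α (A x)
  rcases eq_or_ne β α with rfl | h
  · rw [spectralProjection_apply_of_mem hx,
      spectralProjection_apply_of_mem (apply_mem_maxGenEigenspace hx)]
  · rw [spectralProjection_apply_of_mem_of_ne h hx,
      spectralProjection_apply_of_mem_of_ne h (apply_mem_maxGenEigenspace hx), map_zero]

theorem spectralProjection_mul_self (α : ℂ) :
    spectralProjection A α * spectralProjection A α = spectralProjection A α := by
  ext x
  exact spectralProjection_apply_of_mem (spectralProjection_apply_mem A α x)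

theorem spectralProjection_mul_of_ne {α β : ℂ} (h : α ≠ β) :
    spectralProjection A α * spectralProjection A β = 0 := by
  ext x
  exact spectralProjection_apply_of_mem_of_ne h.symm (spectralProjection_apply_mem A β x)

theorem sub_pow_finrank_mul_spectralProjection (α : ℂ) :
    (A - algebraMap ℂ (E →L[ℂ] E) α) ^ Module.finrank ℂ E * spectralProjection A α = 0 := by
  ext x
  have h := spectralProjection_apply_mem A α x
  rw [Module.End.maxGenEigenspace_eq_genEigenspace_finrank, Module.End.mem_genEigenspace_nat,
    LinearMap.mem_ker] at h
  have h1 : ∀ (n : ℕ) (y : E), ((A - algebraMap ℂ (E →L[ℂ] E) α) ^ n) y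
      = (((A : Module.End ℂ E) - α • 1) ^ n) y := by
    intro n
    induction n with
    | zero => simp
    | succ n ih => intro y; rw [pow_succ, pow_succ, mul_apply_eq_comp, ih]; rfl
  exact (h1 _ _).trans h

theorem sum_spectralProjection_eq_one (s : Finset ℂ)
    (hs : ∀ α, Module.End.HasEigenvalue (A : Module.End ℂ E) α → α ∈ s) :
    ∑ α ∈ s, spectralProjection A α = 1 := by
  refine ext_on_maxGenEigenspace (A := A) fun β x hx => ?_
  rw [sum_apply]
  rcases eq_or_ne x 0 with rfl | hx0
  · simp
  have hβ : Module.End.HasEigenvalue (A : Module.End ℂ E) β := by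
    obtain ⟨k, hk⟩ := (Module.End.mem_maxGenEigenspace _ _ _).1 hx
    refine Module.End.hasEigenvalue_of_hasGenEigenvalue (k := k) ?_
    intro hbot
    have : x ∈ Module.End.genEigenspace (A : Module.End ℂ E) β k :=
      (Module.End.mem_genEigenspace_nat).2 hk
    rw [hbot] at this
    exact hx0 ((Submodule.mem_bot ℂ).1 this)
  rw [Finset.sum_eq_single β
    (fun α _ hα => spectralProjection_apply_of_mem_of_ne hα.symm hx)
    (fun h => absurd (hs β hβ) h), spectralProjection_apply_of_mem hx]
  rfl

theorem mem_peripheralSpectrum {α : ℂ} :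
    α ∈ peripheralSpectrum A ↔ Module.End.HasEigenvalue (A : Module.End ℂ E) α ∧ α.re = 0 := by
  simp [peripheralSpectrum]

theorem commute_peripheralProjection : Commute A (peripheralProjection A) :=
  Commute.sum_right _ _ _ fun α _ => commute_spectralProjection A α

variable {A} in
theorem peripheralProjection_mul_spectralProjection {α : ℂ} (hα : α ∈ peripheralSpectrum A) :
    peripheralProjection A * spectralProjection A α = spectralProjection A α := by
  rw [peripheralProjection, Finset.sum_mul, Finset.sum_eq_single α
    (fun β _ hβ => spectralProjection_mul_of_ne A hβ) (fun h => absurd hα h),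
    spectralProjection_mul_self]

variable {A} in
theorem spectralProjection_mul_peripheralProjection {α : ℂ} (hα : α ∈ peripheralSpectrum A) :
    spectralProjection A α * peripheralProjection A = spectralProjection A α := by
  rw [peripheralProjection, Finset.mul_sum, Finset.sum_eq_single α
    (fun β _ hβ => spectralProjection_mul_of_ne A hβ.symm) (fun h => absurd hα h),
    spectralProjection_mul_self]

theorem peripheralProjection_mul_zenoProjection (L : E →L[ℂ] E) :
    peripheralProjection A * zenoProjection A L = zenoProjection A L := by
  rw [zenoProjection, Finset.mul_sum]
  refine Finset.sum_congr rfl fun α hα => ?_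
  rw [← mul_assoc, ← mul_assoc, peripheralProjection_mul_spectralProjection hα]

theorem zenoProjection_mul_peripheralProjection (L : E →L[ℂ] E) :
    zenoProjection A L * peripheralProjection A = zenoProjection A L := by
  rw [zenoProjection, Finset.sum_mul]
  refine Finset.sum_congr rfl fun α hα => ?_
  rw [mul_assoc, spectralProjection_mul_peripheralProjection hα]

variable {A} in
/-- A reduced resolvent at a semisimple eigenvalue. -/
theorem exists_sub_mul_eq_one_sub_spectralProjection {α : ℂ}
    (h : (A - algebraMap ℂ (E →L[ℂ] E) α) * spectralProjection A α = 0) :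
    ∃ R : E →L[ℂ] E, (A - algebraMap ℂ (E →L[ℂ] E) α) * R = 1 - spectralProjection A α := by
  set p := spectralProjection A α
  set N := A - algebraMap ℂ (E →L[ℂ] E) α
  have hpN : p * N = 0 := by
    rw [← h]
    exact ((commute_spectralProjection A α).sub_left (Algebra.commutes _ _)).eq.symm
  have hpp : p * p = p := spectralProjection_mul_self A α
  have hpB : p * (N + p) = p := by rw [mul_add, hpN, hpp, zero_add]
  -- If `(N + p) x = 0`, then `p x = 0` by `hpB`, so `N x = 0`; thus `x` lies in the range of `p`
  -- and `x = p x = 0`.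
  have hinj : Function.Injective ((N + p : E →L[ℂ] E) : E →ₗ[ℂ] E) := by
    rw [← LinearMap.ker_eq_bot, LinearMap.ker_eq_bot']
    intro x hx
    have hx' : (N + p) x = 0 := hx
    have hpx : p x = 0 := by
      rw [← hpB, mul_apply_eq_comp, hx', map_zero]
    have hNx : N x = 0 := by simpa [hpx] using hx'
    have hxα : x ∈ Module.End.maxGenEigenspace (A : Module.End ℂ E) α := by
      refine (Module.End.mem_maxGenEigenspace _ _ _).2 ⟨1, ?_⟩
      rw [pow_one]
      exact hNx
    rw [← spectralProjection_apply_of_mem hxα]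
    exact hpx
  obtain ⟨R, hR⟩ : ∃ R : E →L[ℂ] E, (N + p) * R = 1 :=
    ⟨LinearMap.toContinuousLinearMap (LinearEquiv.ofInjectiveEndo _ hinj).symm,
      ContinuousLinearMap.ext fun x => (LinearEquiv.ofInjectiveEndo _ hinj).apply_symm_apply x⟩
  refine ⟨R * (1 - p), ?_⟩
  have hpR : p * R = p := by
    conv_lhs => rw [← hpB, mul_assoc, hR, mul_one]
  have hN : N * R = 1 - p := by rw [← hR, add_mul, hpR, add_sub_cancel_right]
  rw [← mul_assoc, hN, mul_sub, mul_one, sub_mul, one_mul, hpp, sub_self, sub_zero]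

variable {A} {C : ℝ} (hA : ∀ t : ℝ, 0 ≤ t → ‖NormedSpace.exp ((t : ℂ) • A)‖ ≤ C)
include hA

theorem sub_mul_spectralProjection_eq_zero {α : ℂ} (hα : α ∈ peripheralSpectrum A) :
    (A - algebraMap ℂ (E →L[ℂ] E) α) * spectralProjection A α = 0 :=
  have : CompleteSpace E := FiniteDimensional.complete ℂ E
  sub_mul_eq_zero_of_sub_pow_mul_eq_zero hA ((mem_peripheralSpectrum A).1 hα).2
    (sub_pow_finrank_mul_spectralProjection A α)

theorem mul_spectralProjection_eq_smul {α : ℂ} (hα : α ∈ peripheralSpectrum A) :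
    A * spectralProjection A α = α • spectralProjection A α := by
  have h := sub_mul_spectralProjection_eq_zero hA hα
  rwa [sub_mul, sub_eq_zero, ← Algebra.smul_def] at h

/-- By semisimplicity `A` acts as the scalar `α` on both sides of each summand. -/
theorem commute_zenoProjection (L : E →L[ℂ] E) : Commute A (zenoProjection A L) := by
  refine Commute.sum_right _ _ _ fun α hα => ?_
  have h := mul_spectralProjection_eq_smul hA hα
  have h' : spectralProjection A α * A = α • spectralProjection A α := by
    rw [← (commute_spectralProjection A α).eq, h]
  change _ = _
  rw [← mul_assoc, ← mul_assoc, h, mul_assoc _ _ A, h', smul_mul_assoc, smul_mul_assoc,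
    mul_smul_comm]

/-- With `(A - α) R_α = 1 - P_α` and `P_α A = α P_α`, the commutator of `A` with `R_α L P_α` is `(1
- P_α) L P_α`; summing over `α` gives the right-hand side. -/
theorem exists_commutator_eq (L : E →L[ℂ] E) :
    ∃ X : E →L[ℂ] E, A * X - X * A = L * peripheralProjection A - zenoProjection A L := by
  choose! R hR using fun α (hα : α ∈ peripheralSpectrum A) =>
    exists_sub_mul_eq_one_sub_spectralProjection (sub_mul_spectralProjection_eq_zero hA hα)
  refine ⟨∑ α ∈ peripheralSpectrum A, R α * L * spectralProjection A α, ?_⟩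
  rw [peripheralProjection, zenoProjection, Finset.mul_sum, Finset.sum_mul, Finset.mul_sum,
    ← Finset.sum_sub_distrib, ← Finset.sum_sub_distrib]
  refine Finset.sum_congr rfl fun α hα => ?_
  have h' : spectralProjection A α * A = α • spectralProjection A α := by
    rw [← (commute_spectralProjection A α).eq, mul_spectralProjection_eq_smul hA hα]
  have hAR : A * R α = 1 - spectralProjection A α + α • R α := by
    rw [← hR α hα, sub_mul, ← Algebra.smul_def, sub_add_cancel]
  rw [mul_assoc _ _ A, h', ← mul_assoc, ← mul_assoc, hAR, mul_smul_comm]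
  simp only [add_mul, sub_mul, one_mul, smul_mul_assoc]
  abel

/-- `1 - P_φ` is the sum of the other spectral projections: those with `Re α < 0` decay, and those
with `Re α > 0` vanish by boundedness. -/
theorem exists_norm_exp_mul_one_sub_peripheralProjection_le :
    ∃ K δ : ℝ, 0 < δ ∧ ∀ t : ℝ, 0 ≤ t →
      ‖NormedSpace.exp ((t : ℂ) • A) * (1 - peripheralProjection A)‖
        ≤ K * Real.exp (-(δ * t)) := by
  classical
  have : CompleteSpace E := FiniteDimensional.complete ℂ E
  set σ := (Module.End.finite_hasEigenvalue (A : Module.End ℂ E)).toFinset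
  have hσ : ∀ α, α ∈ σ ↔ Module.End.HasEigenvalue (A : Module.End ℂ E) α := fun α => by simp [σ]
  have hsub : peripheralSpectrum A ⊆ σ := fun α hα =>
    (hσ α).2 ((mem_peripheralSpectrum A).1 hα).1
  have h1 : 1 - peripheralProjection A
      = ∑ α ∈ σ \ peripheralSpectrum A, spectralProjection A α := by
    rw [← sum_spectralProjection_eq_one A σ fun α => (hσ α).2, peripheralProjection,
      ← Finset.sum_sdiff hsub, add_sub_cancel_right]
  rw [h1]
  refine exists_norm_exp_smul_mul_sum_le _ fun α hα => ?_
  rw [Finset.mem_sdiff, hσ, mem_peripheralSpectrum] at hα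
  have hn := sub_pow_finrank_mul_spectralProjection A α
  rcases lt_trichotomy α.re 0 with h | h | h
  · exact exists_norm_exp_smul_mul_le hn h
  · exact absurd ⟨hα.1, h⟩ hα.2
  · refine ⟨0, 1, one_pos, fun t _ => ?_⟩
    rw [eq_zero_of_sub_pow_mul_eq_zero_of_re_pos hA h hn]
    simp

end SpectralProjections

/-! ### The strong-coupling limit -/

theorem theorem2 {H : Type*} [NormedAddCommGroup H] [InnerProductSpace ℂ H] [CompleteSpace H]
    [FiniteDimensional ℂ H] (L D : (H →L[ℂ] H) →L[ℂ] (H →L[ℂ] H))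
    (hL : IsGKLS L) (hD : IsGKLS D) :
    IsBigOInvUniformlyOnCompacts
        (fun γ t : ℝ =>
          NormedSpace.exp ((t : ℂ) • ((γ : ℂ) • D + L))
            - NormedSpace.exp (((t : ℂ) * (γ : ℂ)) • D)
              * NormedSpace.exp ((t : ℂ) • zenoProjection D L))
        (Set.Ici 0) ∧
      IsBigOInvUniformlyOnCompacts
        (fun γ t : ℝ =>
          NormedSpace.exp ((t : ℂ) • ((γ : ℂ) • D + L))
            - NormedSpace.exp (((t : ℂ) * (γ : ℂ)) • D)
              * NormedSpace.exp ((t : ℂ) • zenoProjection D L)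
              * peripheralProjection D)
        (Set.Ioi 0) := by
  have hDbound : ∀ t : ℝ, 0 ≤ t →
      ‖NormedSpace.exp ((t : ℂ) • D)‖ ≤ 4 * Module.finrank ℂ H := fun t ht =>
    (hD.smul ht).norm_exp_le
  have hDLbound : ∀ γ t : ℝ, 0 ≤ γ → 0 ≤ t →
      ‖NormedSpace.exp ((t : ℂ) • ((γ : ℂ) • D + L))‖ ≤ 4 * Module.finrank ℂ H :=
    fun γ t hγ ht => (((hD.smul hγ).add hL).smul ht).norm_exp_le
  obtain ⟨X, hX⟩ := exists_commutator_eq hDbound L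
  obtain ⟨K, δ, hδ, hdecay⟩ := exists_norm_exp_mul_one_sub_peripheralProjection_le hDbound
  have hfirst := isBigOInv_exp_sub_exp_mul_exp (commute_zenoProjection hDbound L)
    (commute_peripheralProjection D) (peripheralProjection_mul_zenoProjection D L) hX hδ hDbound
    hDLbound hdecay
  refine ⟨hfirst, ?_⟩
  -- Hence `exp (t L_Z)` fixes `1 - P_φ`, and the two approximations differ exactly by `exp (tγD) (1
  -- - P_φ)`.
  have hZ : zenoProjection D L * (1 - peripheralProjection D) = 0 := by
    rw [mul_sub, mul_one, zenoProjection_mul_peripheralProjection, sub_self]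
  intro S hS hSc
  obtain ⟨c, γ₀, hγ₀, hc⟩ := ((hfirst.mono Set.Ioi_subset_Ici_self).add
    (isBigOInv_exp_mul_one_sub hδ hdecay)) S hS hSc
  refine ⟨c, γ₀, hγ₀, fun γ hγ t ht => ?_⟩
  refine (congrArg norm ?_).trans_le (hc γ hγ t ht)
  have h := exp_smul_mul_of_mul_eq_zero hZ (t : ℂ)
  rw [mul_sub, mul_one, sub_eq_iff_eq_add] at h
  beta_reduce
  nth_rewrite 2 [h]
  rw [mul_add, mul_assoc]
  abel
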